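/- Let $X_1,\dots,X_n$ ($n\ge 2$) be independent random variables, each normally distributed with mean $\mu$ and variance $\sigma^2$, $\sigma>0$. Let $T$ be a target and $k>1$. Put $\bar X=\frac1n\sum_{i=1}^n X_i$, $S_n^2=\frac1n\sum_{i=1}^n (X_i-\bar X)^2$ and $S_{n-1}^2=\frac1{n-1}\sum_{i=1}^n(X_i-\bar X)^2$. Upper tolerance. Let $U>T$ and put $C_{pu}=\frac{U-T}{3\sigma}$. For $m\in\{n,n-1\}$ and real $u,v$ let $$\hat C_{pu,m}(u,v)=\frac{U-T-u\hat A_u^*}{3\sqrt{S_m^2+v\hat A_u^{*2}}},\qquad \hat A_u^*=\max\Bigl\{\bar X-T,\frac{T-\bar X}{k}\Bigr\},$$ and let $\hat C_{pu,m}=\hat C_{pu,m}(0,0)=\frac{U-T}{3S_m}$. Then the following hold. 1. If a lower limit $L$ is placed so that $T-L=k(U-T)$, and $C_p=\frac{U-L}{6\sigma}$, then $C_{pu}=\frac{2}{1+k}\,C_p$. 2. The law of $\hat C_{pu,n-1}$ has the Lebesgue density which is $0$ for $x\le 0$ and $$f_{\hat C_{pu,n-1}}(x)=\frac{(n-1)^{(n-1)/2}}{C_{pu}\,\Gamma\left(\frac{n-1}2\right)2^{(n-3)/2}}\left(\frac{C_{pu}}{x}\right)^{n}e^{-\frac{n-1}{2}\left(\frac{C_{pu}}{x}\right)^2},\qquad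 x>0.$$ For every integer $r$ with $0\le r<n-1$ the $r$-th moment is finite and $$E\left[\hat C_{pu,n-1}^{\,r}\right]=\left(\frac{n-1}{2}\right)^{r/2}\frac{\Gamma\left(\frac{n-1-r}{2}\right)}{\Gamma\left(\frac{n-1}{2}\right)}\,C_{pu}^{\,r}.$$ In particular, with $b_f=\sqrt{\frac{2}{n-1}}\;\frac{\Gamma((n-1)/2)}{\Gamma((n-2)/2)}$: if $n\ge 3$, the mean is finite and $E[\hat C_{pu,n-1}]=b_f^{-1}C_{pu}$; if $n\ge 4$, the variance is finite and $V(\hat C_{pu,n-1})=\left(\frac{n-1}{n-3}-b_f^{-2}\right)C_{pu}^2$. 3. $\hat C_{pu,n}=\left(\frac{n}{n-1}\right)^{1/2}\hat C_{pu,n-1}$. The law of $\hat C_{pu,n}$ has the Lebesgue density which is $0$ for $x\le 0$ and $$f_{\hat C_{pu,n}}(x)=\frac{n^{(n-1)/2}}{C_{pu}\,\Gamma\left(\frac{n-1}2\right)2^{(n-3)/2}}\left(\frac{C_{pu}}{x}\right)^{n}e^{-\frac{n}{2}\left(\frac{C_{pu}}{x}\right)^2},\qquad x>0.$$ For every integer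 $r$ with $0\le r<n-1$ the $r$-th moment is finite and $$E\left[\hat C_{pu,n}^{\,r}\right]=\left(\frac{n}{2}\right)^{r/2}\frac{\Gamma\left(\frac{n-1-r}{2}\right)}{\Gamma\left(\frac{n-1}{2}\right)}\,C_{pu}^{\,r}.$$ In particular, with $c_f=\sqrt{\frac{2}{n}}\;\frac{\Gamma((n-1)/2)}{\Gamma((n-2)/2)}$: if $n\ge 3$, the mean is finite and $E[\hat C_{pu,n}]=c_f^{-1}C_{pu}$; if $n\ge 4$, the variance is finite and $V(\hat C_{pu,n})=\left(\frac{n}{n-3}-c_f^{-2}\right)C_{pu}^2$. Lower tolerance. Let $L<T$ and put $C_{pl}=\frac{T-L}{3\sigma}$. For $m\in\{n,n-1\}$ and real $u,v$ let $$\hat C_{pl,m}(u,v)=\frac{T-L-u\hat A_l^*}{3\sqrt{S_m^2+v\hat A_l^{*2}}},\qquad \hat A_l^*=\max\Bigl\{\frac{\bar X-T}{k},T-\bar X\Bigr\},$$ and let $\hat C_{pl,m}=\hat C_{pl,m}(0,0)=\frac{T-L}{3S_m}$. If an upper limit $U$ is placed so that $U-T=k(T-L)$, then $C_{pl}=\frac{2}{1+k}C_p$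 with $C_p=\frac{U-L}{6\sigma}$. All assertions of 2 and 3 hold with $C_{pu},\hat C_{pu,n-1},\hat C_{pu,n}$ replaced by $C_{pl},\hat C_{pl,n-1},\hat C_{pl,n}$. -/

import Mathlib

open MeasureTheory ProbabilityTheory

noncomputable section

namespace Capability

/-- Bilateral potential capability index `C_p = (U - L) / (6 σ)`. -/
def Cp (L U σ : ℝ) : ℝ := (U - L) / (6 * σ)

/-- Potential capability index for a single upper tolerance limit `U` and target `T`. -/
def Cpu (U T σ : ℝ) : ℝ := (U - T) / (3 * σ)

/-- Potential capability index for a single lower tolerance limit `L` and target `T`. -/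
def Cpl (L T σ : ℝ) : ℝ := (T - L) / (3 * σ)

/-- Sample mean of a sample `x` of size `n`. -/
def sampleMean {n : ℕ} (x : Fin n → ℝ) : ℝ := (∑ i, x i) / n

/-- Sample variance with divisor `n`. -/
def sampleVarN {n : ℕ} (x : Fin n → ℝ) : ℝ :=
  (∑ i, (x i - sampleMean x) ^ 2) / n

/-- Sample variance with divisor `n - 1`. -/
def sampleVarNm1 {n : ℕ} (x : Fin n → ℝ) : ℝ :=
  (∑ i, (x i - sampleMean x) ^ 2) / ((n : ℝ) - 1)

/-- Estimated penalized deviation from the target, upper tolerance. -/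
def devU (T k : ℝ) {n : ℕ} (x : Fin n → ℝ) : ℝ :=
  max (sampleMean x - T) ((T - sampleMean x) / k)

/-- Estimated penalized deviation from the target, lower tolerance. -/
def devL (T k : ℝ) {n : ℕ} (x : Fin n → ℝ) : ℝ :=
  max ((sampleMean x - T) / k) (T - sampleMean x)

/-- The estimator `Ĉ_{pu,n}(u,v)`. -/
def estUFamilyN (U T k u v : ℝ) {n : ℕ} (x : Fin n → ℝ) : ℝ :=
  (U - T - u * devU T k x) / (3 * Real.sqrt (sampleVarN x + v * devU T k x ^ 2))

/-- The estimator `Ĉ_{pu,n-1}(u,v)`. -/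
def estUFamilyNm1 (U T k u v : ℝ) {n : ℕ} (x : Fin n → ℝ) : ℝ :=
  (U - T - u * devU T k x) / (3 * Real.sqrt (sampleVarNm1 x + v * devU T k x ^ 2))

/-- The estimator `Ĉ_{pl,n}(u,v)`. -/
def estLFamilyN (L T k u v : ℝ) {n : ℕ} (x : Fin n → ℝ) : ℝ :=
  (T - L - u * devL T k x) / (3 * Real.sqrt (sampleVarN x + v * devL T k x ^ 2))

/-- The estimator `Ĉ_{pl,n-1}(u,v)`. -/
def estLFamilyNm1 (L T k u v : ℝ) {n : ℕ} (x : Fin n → ℝ) : ℝ :=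
  (T - L - u * devL T k x) / (3 * Real.sqrt (sampleVarNm1 x + v * devL T k x ^ 2))

/-- `Ĉ_{pu,n}`: the member `(u, v) = (0, 0)` of the family, that is `(U - T) / (3 S_n)`. -/
def estCpuN (U T k : ℝ) {n : ℕ} (x : Fin n → ℝ) : ℝ := estUFamilyN U T k 0 0 x

/-- `Ĉ_{pu,n-1}`: the member `(u, v) = (0, 0)` of the family, that is
`(U - T) / (3 S_{n-1})`. -/
def estCpuNm1 (U T k : ℝ) {n : ℕ} (x : Fin n → ℝ) : ℝ := estUFamilyNm1 U T k 0 0 x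

/-- `Ĉ_{pl,n}`: the member `(u, v) = (0, 0)` of the family, that is `(T - L) / (3 S_n)`. -/
def estCplN (L T k : ℝ) {n : ℕ} (x : Fin n → ℝ) : ℝ := estLFamilyN L T k 0 0 x

/-- `Ĉ_{pl,n-1}`: the member `(u, v) = (0, 0)` of the family, that is
`(T - L) / (3 S_{n-1})`. -/
def estCplNm1 (L T k : ℝ) {n : ℕ} (x : Fin n → ℝ) : ℝ := estLFamilyNm1 L T k 0 0 x

/-- The density claimed for the estimators with divisor `n - 1`; `C` is the true index. -/
def densityNm1 (n : ℕ) (C x : ℝ) : ℝ :=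
  if 0 < x then
    ((n : ℝ) - 1) ^ (((n : ℝ) - 1) / 2) /
        (C * Real.Gamma (((n : ℝ) - 1) / 2) * (2 : ℝ) ^ (((n : ℝ) - 3) / 2)) *
      (C / x) ^ n * Real.exp (-(((n : ℝ) - 1) / 2 * (C / x) ^ 2))
  else 0

/-- The density claimed for the estimators with divisor `n`; `C` is the true index. -/
def densityN (n : ℕ) (C x : ℝ) : ℝ :=
  if 0 < x then
    (n : ℝ) ^ (((n : ℝ) - 1) / 2) /
        (C * Real.Gamma (((n : ℝ) - 1) / 2) * (2 : ℝ) ^ (((n : ℝ) - 3) / 2)) *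
      (C / x) ^ n * Real.exp (-((n : ℝ) / 2 * (C / x) ^ 2))
  else 0

/-- The constant `b_f`. -/
def bf (n : ℕ) : ℝ :=
  Real.sqrt (2 / ((n : ℝ) - 1)) * Real.Gamma (((n : ℝ) - 1) / 2) / Real.Gamma (((n : ℝ) - 2) / 2)

/-- The constant `c_f`. -/
def cf (n : ℕ) : ℝ :=
  Real.sqrt (2 / (n : ℝ)) * Real.Gamma (((n : ℝ) - 1) / 2) / Real.Gamma (((n : ℝ) - 2) / 2)

/-- The real random variable `Y` has Lebesgue density `f` under `P`. -/
def HasDensity {Ω : Type*} [MeasurableSpace Ω] (P : Measure Ω) (Y : Ω → ℝ) (f : ℝ → ℝ) : Prop :=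
  HasLaw Y (volume.withDensity fun x => ENNReal.ofReal (f x)) P

end Capability

end

open Capability

/-! After standardisation the sample is a standard Gaussian vector of `ℝ^n`. Its residuals form the
orthogonal projection onto the hyperplane orthogonal to the all-ones vector, and that projection is
standard Gaussian in dimension `n - 1`. So the sum of squared deviations is `σ² ‖Z‖²`, and all four
estimators have the form `C √m / ‖Z‖`, with `C` the true index and `m` the divisor.

Everything then concerns the inverse norm of a standard Gaussian. Polar coordinates
(`integral_comp_norm_stdGaussian`) turn moments into Gamma integrals, and the substitution `y = a /
x` gives the density (`hasLaw_div_norm_stdGaussian`). -/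

/-! ### Density and projections of the standard Gaussian -/

theorem integrable_exp_neg_half_norm_sq (E : Type*) [NormedAddCommGroup E] [InnerProductSpace ℝ E]
    [FiniteDimensional ℝ E] [MeasurableSpace E] [BorelSpace E] :
    Integrable fun x : E => Real.exp (-(1 / 2) * ‖x‖ ^ 2) := by
  have h := (GaussianFourier.integrable_cexp_neg_mul_sq_norm_add (V := E) (b := 1 / 2)
    (by norm_num) 0 0).re
  refine h.congr (ae_of_all _ fun x => ?_)
  simp only [zero_mul, add_zero]
  rw [show (-(1 / 2 : ℂ)) * (‖x‖ : ℂ) ^ 2 = ((-(1 / 2) * ‖x‖ ^ 2 : ℝ) : ℂ) by push_cast; ring]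
  exact Complex.exp_ofReal_re _

/-- Both measures have the same characteristic function, by the Gaussian Fourier integral. An
explicit radial density is what makes polar coordinates applicable. -/
theorem stdGaussian_eq_withDensity (E : Type*) [NormedAddCommGroup E] [InnerProductSpace ℝ E]
    [FiniteDimensional ℝ E] [MeasurableSpace E] [BorelSpace E] :
    stdGaussian E = volume.withDensity fun x => ENNReal.ofReal
      (((2 * Real.pi) ^ ((Module.finrank ℝ E : ℝ) / 2))⁻¹ * Real.exp (-(1 / 2) * ‖x‖ ^ 2)) := by
  set c : ℝ := ((2 * Real.pi) ^ ((Module.finrank ℝ E : ℝ) / 2))⁻¹ with hc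
  have hc0 : 0 < c := by positivity
  have hint := (integrable_exp_neg_half_norm_sq E).const_mul c
  have hfin : IsFiniteMeasure (volume.withDensity fun x : E => ENNReal.ofReal
      (c * Real.exp (-(1 / 2) * ‖x‖ ^ 2))) :=
    isFiniteMeasure_withDensity_ofReal hint.2
  refine Measure.ext_of_charFun (funext fun t => ?_)
  rw [charFun_stdGaussian, charFun_apply, integral_withDensity_eq_integral_toReal_smul
    (by fun_prop) (ae_of_all _ fun x => ENNReal.ofReal_lt_top)]
  have key := GaussianFourier.integral_cexp_neg_mul_sq_norm_add (V := E) (b := 1 / 2)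
    (by norm_num) Complex.I t
  have hpt : ∀ x : E, (ENNReal.ofReal (c * Real.exp (-(1 / 2) * ‖x‖ ^ 2))).toReal •
      Complex.exp (inner ℝ x t * Complex.I) =
      (c : ℂ) * Complex.exp (-(1 / 2) * (‖x‖ : ℂ) ^ 2 + Complex.I * inner ℝ t x) := by
    intro x
    rw [ENNReal.toReal_ofReal (by positivity), Complex.real_smul, Complex.exp_add, real_inner_comm]
    push_cast
    ring_nf
  simp_rw [hpt]
  rw [integral_const_mul, key, hc]
  have h2 : ((2 * Real.pi : ℝ) : ℂ) ^ ((Module.finrank ℝ E : ℂ) / 2) =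
      (((2 * Real.pi) ^ ((Module.finrank ℝ E : ℝ) / 2) : ℝ) : ℂ) := by
    rw [Complex.ofReal_cpow (by positivity)]
    push_cast
    rfl
  rw [show (Real.pi : ℂ) / (1 / 2) = ((2 * Real.pi : ℝ) : ℂ) by push_cast; ring, h2, ← mul_assoc,
    ← Complex.ofReal_mul, inv_mul_cancel₀ (by positivity), Complex.I_sq]
  simp only [Complex.ofReal_one, one_mul]
  congr 1
  ring

/-- For `t ∈ K`, pairing with `t` does not see the component orthogonal to `K`, so the
characteristic functions agree. -/
theorem stdGaussian_map_orthogonalProjectionOnto {E : Type*} [NormedAddCommGroup E]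
    [InnerProductSpace ℝ E] [FiniteDimensional ℝ E] [MeasurableSpace E] [BorelSpace E]
    (K : Submodule ℝ E) :
    (stdGaussian E).map K.orthogonalProjectionOnto = stdGaussian K := by
  have : IsProbabilityMeasure ((stdGaussian E).map K.orthogonalProjectionOnto) :=
    Measure.isProbabilityMeasure_map (by fun_prop)
  refine Measure.ext_of_charFun (funext fun t => ?_)
  rw [charFun_apply, integral_map (by fun_prop) (by fun_prop)]
  have h := charFun_stdGaussian (t : E)
  rw [charFun_apply] at h
  simp_rw [Submodule.inner_orthogonalProjectionOnto_eq_of_mem_right, charFun_stdGaussian]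
  rw [Submodule.coe_norm] at *
  simpa [real_inner_comm] using h

/-! ### Polar coordinates -/

section Radial

variable {E : Type*} [NormedAddCommGroup E] [InnerProductSpace ℝ E] [FiniteDimensional ℝ E]
  [MeasurableSpace E] [BorelSpace E] [Nontrivial E]

theorem integrable_comp_norm_stdGaussian_iff {g : ℝ → ℝ} :
    Integrable (fun x : E => g ‖x‖) (stdGaussian E) ↔
      IntegrableOn (fun y : ℝ => y ^ (Module.finrank ℝ E - 1) *
        (Real.exp (-(1 / 2) * y ^ 2) * g y)) (Set.Ioi 0) := by
  set c : ℝ := ((2 * Real.pi) ^ ((Module.finrank ℝ E : ℝ) / 2))⁻¹ with hc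
  have hc0 : 0 < c := by positivity
  rw [stdGaussian_eq_withDensity, integrable_withDensity_iff_integrable_smul' (by fun_prop)
    (ae_of_all _ fun x => ENNReal.ofReal_lt_top)]
  have hpt : (fun x : E => (ENNReal.ofReal (c * Real.exp (-(1 / 2) * ‖x‖ ^ 2))).toReal • g ‖x‖) =
      fun x : E => (fun y => c * (Real.exp (-(1 / 2) * y ^ 2) * g y)) ‖x‖ := by
    funext x
    rw [ENNReal.toReal_ofReal (by positivity), smul_eq_mul, mul_assoc]
  rw [hpt, integrable_const_mul_iff (isUnit_iff_ne_zero.2 hc0.ne'),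
    integrable_fun_norm_addHaar volume (f := fun y => Real.exp (-(1 / 2) * y ^ 2) * g y)]
  simp only [smul_eq_mul]

theorem integral_Ioi_rpow_mul_exp_neg_half_sq {s : ℝ} (hs : -1 < s) :
    ∫ y in Set.Ioi (0 : ℝ), y ^ s * Real.exp (-(1 / 2) * y ^ 2) =
      2 ^ ((s - 1) / 2) * Real.Gamma ((s + 1) / 2) := by
  have h := integral_rpow_mul_exp_neg_mul_rpow (p := 2) (b := 1 / 2) two_pos hs (by norm_num)
  simp_rw [Real.rpow_two] at h
  rw [h, one_div, Real.inv_rpow two_pos.le, ← Real.rpow_neg two_pos.le, ← Real.rpow_neg_one,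
    ← Real.rpow_add two_pos]
  ring_nf

theorem integral_comp_norm_stdGaussian (g : ℝ → ℝ) :
    ∫ x : E, g ‖x‖ ∂(stdGaussian E) =
      (2 ^ ((Module.finrank ℝ E : ℝ) / 2 - 1) * Real.Gamma ((Module.finrank ℝ E : ℝ) / 2))⁻¹ *
        ∫ y in Set.Ioi (0 : ℝ), y ^ (Module.finrank ℝ E - 1) *
          (Real.exp (-(1 / 2) * y ^ 2) * g y) := by
  -- The volume of the unit ball is never evaluated: `K` does not depend on `g`, so `g = 1` and
  -- total mass one determine it.
  obtain ⟨K, hK⟩ : ∃ K : ℝ, ∀ g : ℝ → ℝ, ∫ x : E, g ‖x‖ ∂(stdGaussian E) =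
      K * ∫ y in Set.Ioi (0 : ℝ), y ^ (Module.finrank ℝ E - 1) *
          (Real.exp (-(1 / 2) * y ^ 2) * g y) := by
    set c : ℝ := ((2 * Real.pi) ^ ((Module.finrank ℝ E : ℝ) / 2))⁻¹ with hc
    have hc0 : 0 < c := by positivity
    refine ⟨c * (Module.finrank ℝ E * volume.real (Metric.ball (0 : E) 1)), fun g => ?_⟩
    rw [stdGaussian_eq_withDensity, integral_withDensity_eq_integral_toReal_smul (by fun_prop)
      (ae_of_all _ fun x => ENNReal.ofReal_lt_top)]
    have hpt : ∀ x : E,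
        (ENNReal.ofReal (c * Real.exp (-(1 / 2) * ‖x‖ ^ 2))).toReal • g ‖x‖ =
        c * (fun y => Real.exp (-(1 / 2) * y ^ 2) * g y) ‖x‖ := by
      intro x
      rw [ENNReal.toReal_ofReal (by positivity), smul_eq_mul, mul_assoc]
    refine (integral_congr_ae (ae_of_all _ hpt)).trans ?_
    rw [integral_const_mul, integral_fun_norm_addHaar volume
      (fun y => Real.exp (-(1 / 2) * y ^ 2) * g y)]
    simp only [smul_eq_mul, nsmul_eq_mul]
    ring
  have hd : 1 ≤ Module.finrank ℝ E := Module.finrank_pos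
  have hd' : (1 : ℝ) ≤ Module.finrank ℝ E := by exact_mod_cast hd
  have h1 := hK fun _ => 1
  have h2 := integral_Ioi_rpow_mul_exp_neg_half_sq (s := (Module.finrank ℝ E : ℝ) - 1)
    (by linarith)
  have h3 : ∀ y : ℝ, y ^ (Module.finrank ℝ E - 1) = y ^ ((Module.finrank ℝ E : ℝ) - 1) := by
    intro y
    rw [← Real.rpow_natCast, Nat.cast_sub hd, Nat.cast_one]
  simp only [mul_one, h3, h2] at h1
  rw [integral_const, probReal_univ, one_smul] at h1
  rw [hK g, eq_inv_of_mul_eq_one_left h1.symm]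
  ring_nf

end Radial

/-! ### Residuals as a projected Gaussian vector -/

/-- The hyperplane orthogonal to the all-ones vector. -/
noncomputable abbrev centeredSubspace (n : ℕ) : Submodule ℝ (EuclideanSpace ℝ (Fin n)) :=
  (Submodule.span ℝ {(WithLp.toLp 2 fun _ => (1 : ℝ) : EuclideanSpace ℝ (Fin n))})ᗮ

theorem finrank_centeredSubspace {n : ℕ} (hn : 1 ≤ n) :
    Module.finrank ℝ (centeredSubspace n) = n - 1 := by
  have : Fact (Module.finrank ℝ (EuclideanSpace ℝ (Fin n)) = (n - 1) + 1) :=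
    ⟨by rw [finrank_euclideanSpace_fin]; omega⟩
  refine Submodule.finrank_orthogonal_span_singleton fun h => ?_
  have := congrArg (fun v : EuclideanSpace ℝ (Fin n) => v ⟨0, hn⟩) h
  simp at this

/-- The residuals sum to zero, and what was subtracted is a multiple of the all-ones vector. -/
theorem coe_orthogonalProjectionOnto_centeredSubspace {n : ℕ} (hn : 1 ≤ n) (z : Fin n → ℝ) :
    ((centeredSubspace n).orthogonalProjectionOnto (WithLp.toLp 2 z) : EuclideanSpace ℝ (Fin n)) =
      WithLp.toLp 2 fun i => z i - sampleMean z := by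
  have hn0 : (n : ℝ) ≠ 0 := by positivity
  rw [← Submodule.starProjection_apply]
  refine Submodule.eq_starProjection_of_mem_orthogonal ?_ ?_
  · rw [Submodule.mem_orthogonal_singleton_iff_inner_right]
    simp [PiLp.inner_apply, sampleMean]
    field_simp
    simp
  · rw [Submodule.orthogonal_orthogonal, Submodule.mem_span_singleton]
    refine ⟨sampleMean z, ?_⟩
    ext i
    simp

theorem norm_sq_orthogonalProjectionOnto_centeredSubspace {n : ℕ} (hn : 1 ≤ n) (z : Fin n → ℝ) :
    ‖(centeredSubspace n).orthogonalProjectionOnto (WithLp.toLp 2 z)‖ ^ 2 =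
      ∑ i, (z i - sampleMean z) ^ 2 := by
  rw [Submodule.coe_norm, coe_orthogonalProjectionOnto_centeredSubspace hn,
    EuclideanSpace.real_norm_sq_eq]

theorem sum_sq_sub_sampleMean_affine {n : ℕ} (hn : 1 ≤ n) (z : Fin n → ℝ) (a b : ℝ) :
    ∑ i, ((z i - a) / b - sampleMean fun j => (z j - a) / b) ^ 2 =
      (∑ i, (z i - sampleMean z) ^ 2) / b ^ 2 := by
  have hn0 : (n : ℝ) ≠ 0 := by positivity
  have h : (sampleMean fun j => (z j - a) / b) = (sampleMean z - a) / b := by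
    simp only [sampleMean]
    rw [← Finset.sum_div, Finset.sum_sub_distrib, Finset.sum_const, Finset.card_univ,
      Fintype.card_fin, nsmul_eq_mul]
    field_simp
  rw [h, Finset.sum_div]
  refine Finset.sum_congr rfl fun i _ => ?_
  rw [← sub_div, div_pow]
  ring

theorem exists_hasLaw_stdGaussian_sum_sq_sub_sampleMean {Ω : Type*} [MeasurableSpace Ω]
    {P : Measure Ω} {n : ℕ} (hn : 1 ≤ n) {μ σ : ℝ} (hσ : 0 < σ) {X : Fin n → Ω → ℝ}
    (hindep : iIndepFun X P)
    (hlaw : ∀ i, HasLaw (X i) (gaussianReal μ ⟨σ ^ 2, sq_nonneg σ⟩) P) :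
    ∃ Z : Ω → centeredSubspace n, HasLaw Z (stdGaussian (centeredSubspace n)) P ∧
      ∀ ω, ∑ i, (X i ω - sampleMean fun j => X j ω) ^ 2 = σ ^ 2 * ‖Z ω‖ ^ 2 := by
  have hstd : ∀ i, HasLaw (fun ω => (X i ω - μ) / σ) (gaussianReal 0 1) P := by
    intro i
    have h := gaussianReal_div_const (gaussianReal_sub_const (hlaw i) μ) σ
    convert h using 2
    · simp
    · ext
      exact (div_self (pow_ne_zero 2 hσ.ne')).symm
  have hind : iIndepFun (fun i ω => (X i ω - μ) / σ) P :=
    hindep.comp (fun _ x => (x - μ) / σ) fun _ => by fun_prop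
  have h1 := hind.hasLaw_pi hstd
  have h2 : HasLaw (fun z : Fin n → ℝ => (WithLp.toLp 2 z : EuclideanSpace ℝ (Fin n)))
      (stdGaussian (EuclideanSpace ℝ (Fin n))) (Measure.pi fun _ => gaussianReal 0 1) :=
    ⟨by fun_prop, map_pi_eq_stdGaussian⟩
  have h3 : HasLaw (centeredSubspace n).orthogonalProjectionOnto
      (stdGaussian (centeredSubspace n)) (stdGaussian (EuclideanSpace ℝ (Fin n))) :=
    ⟨by fun_prop, stdGaussian_map_orthogonalProjectionOnto _⟩
  refine ⟨_, h3.fun_comp (h2.fun_comp h1), fun ω => ?_⟩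
  rw [norm_sq_orthogonalProjectionOnto_centeredSubspace hn, sum_sq_sub_sampleMean_affine hn]
  field_simp

/-- The density of the estimators with divisor `m` for a sample of size `n`. -/
noncomputable def indexDensity (n : ℕ) (m C x : ℝ) : ℝ :=
  if 0 < x then
    m ^ (((n : ℝ) - 1) / 2) /
        (C * Real.Gamma (((n : ℝ) - 1) / 2) * (2 : ℝ) ^ (((n : ℝ) - 3) / 2)) *
      (C / x) ^ n * Real.exp (-(m / 2 * (C / x) ^ 2))
  else 0

/-! ### Moments and law of the inverse norm -/

section InverseNorm

variable {E : Type*} [NormedAddCommGroup E] [InnerProductSpace ℝ E] [FiniteDimensional ℝ E]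
  [MeasurableSpace E] [BorelSpace E] [Nontrivial E]

theorem integrable_and_integral_div_norm_pow_stdGaussian (a : ℝ) {r : ℕ}
    (hr : r < Module.finrank ℝ E) :
    Integrable (fun x : E => (a / ‖x‖) ^ r) (stdGaussian E) ∧
      ∫ x : E, (a / ‖x‖) ^ r ∂(stdGaussian E) =
        a ^ r * 2 ^ (-(r : ℝ) / 2) * (Real.Gamma (((Module.finrank ℝ E : ℝ) - r) / 2) /
          Real.Gamma ((Module.finrank ℝ E : ℝ) / 2)) := by
  set d := Module.finrank ℝ E with hd
  have hr' : (r : ℝ) + 1 ≤ d := by exact_mod_cast hr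
  -- Integrability at the origin; this is where `r < d` enters.
  have hs : (-1 : ℝ) < (d : ℝ) - 1 - r := by linarith
  have hpt : Set.EqOn (fun y : ℝ => y ^ (d - 1) * (Real.exp (-(1 / 2) * y ^ 2) * (a / y) ^ r))
      (fun y => a ^ r * (y ^ ((d : ℝ) - 1 - r) * Real.exp (-(1 / 2) * y ^ 2))) (Set.Ioi 0) := by
    intro y (hy : 0 < y)
    have hd1 : (d : ℝ) - 1 = ((d - 1 : ℕ) : ℝ) := by rw [Nat.cast_sub (by omega), Nat.cast_one]
    simp only
    rw [Real.rpow_sub hy, Real.rpow_natCast, hd1, Real.rpow_natCast, div_pow]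
    ring
  refine ⟨?_, ?_⟩
  · rw [integrable_comp_norm_stdGaussian_iff (g := fun y => (a / y) ^ r),
      integrableOn_congr_fun hpt measurableSet_Ioi]
    exact (integrableOn_rpow_mul_exp_neg_mul_sq (by norm_num) hs).const_mul _
  · rw [integral_comp_norm_stdGaussian (fun y => (a / y) ^ r),
      setIntegral_congr_fun measurableSet_Ioi hpt, integral_const_mul,
      integral_Ioi_rpow_mul_exp_neg_half_sq hs, ← hd,
      show ((d : ℝ) - 1 - r - 1) / 2 = (d / 2 - 1) + -(r : ℝ) / 2 by ring,
      Real.rpow_add two_pos, show (d : ℝ) - 1 - r + 1 = d - r by ring]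
    field_simp

theorem image_div_Ioi {a : ℝ} (ha : 0 < a) :
    (fun x : ℝ => a / x) '' Set.Ioi 0 = Set.Ioi 0 := by
  ext y
  constructor
  · rintro ⟨x, hx, rfl⟩
    exact div_pos ha hx
  · intro hy
    exact ⟨a / y, div_pos ha hy, div_div_cancel₀ ha.ne'⟩

/-- The probability of a set is the integral of its indicator, a function of the norm; in polar
coordinates `y = a / x` brings in the Jacobian `a / x ^ 2`. -/
theorem hasLaw_div_norm_stdGaussian {a : ℝ} (ha : 0 < a) :
    HasLaw (fun x : E => a / ‖x‖) (volume.withDensity fun x => ENNReal.ofReal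
      (if 0 < x then (2 ^ ((Module.finrank ℝ E : ℝ) / 2 - 1) *
          Real.Gamma ((Module.finrank ℝ E : ℝ) / 2))⁻¹ *
        (a / x ^ 2 * ((a / x) ^ (Module.finrank ℝ E - 1) * Real.exp (-(1 / 2) * (a / x) ^ 2)))
        else 0)) (stdGaussian E) := by
  set d := Module.finrank ℝ E with hd
  have hd0 : (0 : ℝ) < d := by exact_mod_cast (Module.finrank_pos : 0 < Module.finrank ℝ E)
  set K : ℝ := (2 ^ ((d : ℝ) / 2 - 1) * Real.Gamma ((d : ℝ) / 2))⁻¹ with hK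
  have hK0 : 0 < K := inv_pos.2 (mul_pos (by positivity) (Real.Gamma_pos_of_pos (by positivity)))
  set f : ℝ → ℝ := fun x => if 0 < x then
    K * (a / x ^ 2 * ((a / x) ^ (d - 1) * Real.exp (-(1 / 2) * (a / x) ^ 2))) else 0 with hf
  have hf0 : ∀ x, 0 ≤ f x := by
    intro x
    simp only [hf]
    split_ifs <;> positivity
  have hmeas : Measurable fun x : E => a / ‖x‖ := by fun_prop
  refine ⟨hmeas.aemeasurable, Measure.ext fun s hs => ?_⟩
  set φ : ℝ → ℝ := s.indicator fun _ => 1 with hφ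
  have hderiv : ∀ x ∈ Set.Ioi (0 : ℝ), HasDerivWithinAt (fun x => a / x) (-(a / x ^ 2))
      (Set.Ioi 0) x := by
    intro x (hx : 0 < x)
    have h := ((hasDerivAt_inv hx.ne').const_mul a).hasDerivWithinAt (s := Set.Ioi 0)
    simp only [div_eq_mul_inv]
    exact h.congr_deriv (by ring)
  have hinj : Set.InjOn (fun x : ℝ => a / x) (Set.Ioi 0) := fun x _ y _ h => by
    simpa [div_eq_mul_inv, ha.ne'] using h
  have hpt : Set.EqOn (fun x => K * (|-(a / x ^ 2)| • ((a / x) ^ (d - 1) *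
      (Real.exp (-(1 / 2) * (a / x) ^ 2) * φ (a / (a / x)))))) (s.indicator f) (Set.Ioi 0) := by
    intro x (hx : 0 < x)
    have : |-(a / x ^ 2)| = a / x ^ 2 := by rw [abs_neg, abs_of_nonneg (by positivity)]
    simp only [this, div_div_cancel₀ ha.ne', smul_eq_mul, hφ]
    by_cases hxs : x ∈ s <;> simp [hxs, hf, hx]
  have hsupp : Function.support (s.indicator f) ⊆ Set.Ioi 0 := by
    intro x hx
    by_contra hx0
    refine hx ?_
    have : f x = 0 := if_neg hx0
    simp [this]
  have hint : Integrable (fun x : E => φ (a / ‖x‖)) (stdGaussian E) := by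
    refine Integrable.of_bound (C := 1) ?_ (ae_of_all _ fun x => ?_)
    · exact ((measurable_const.indicator hs).comp hmeas).aestronglyMeasurable
    · by_cases hx : a / ‖x‖ ∈ s <;> simp [hφ, hx]
  -- Needed to pass from the `lintegral` to the Bochner integral. It comes from the bounded
  -- indicator on a probability space, carried through polar coordinates and the substitution.
  have hint' : IntegrableOn f s := by
    rw [integrable_comp_norm_stdGaussian_iff (g := fun y => φ (a / y)), ← hd] at hint
    rw [← image_div_Ioi ha, integrableOn_image_iff_integrableOn_abs_deriv_smul measurableSet_Ioi
      hderiv hinj] at hint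
    have h := hint.const_mul K
    rw [← IntegrableOn, integrableOn_congr_fun hpt measurableSet_Ioi,
      integrableOn_iff_integrable_of_support_subset hsupp] at h
    exact (integrable_indicator_iff hs).1 h
  rw [withDensity_apply _ hs, ← ofReal_integral_eq_lintegral_ofReal hint' (ae_of_all _ hf0),
    Measure.map_apply hmeas hs, ← ofReal_measureReal]
  congr 1
  calc (stdGaussian E).real ((fun x : E => a / ‖x‖) ⁻¹' s)
      = ∫ x : E, φ (a / ‖x‖) ∂(stdGaussian E) := by
        rw [← integral_indicator_one (hmeas hs)]
        rfl
    _ = K * ∫ y in Set.Ioi (0 : ℝ), y ^ (d - 1) * (Real.exp (-(1 / 2) * y ^ 2) * φ (a / y)) :=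
        integral_comp_norm_stdGaussian fun y => φ (a / y)
    _ = ∫ x in s, f x := by
        rw [← image_div_Ioi ha, integral_image_eq_integral_abs_deriv_smul measurableSet_Ioi
          hderiv hinj, ← integral_const_mul, setIntegral_congr_fun measurableSet_Ioi hpt,
          setIntegral_eq_integral_of_forall_compl_eq_zero fun x hx =>
            Function.notMem_support.1 fun h => hx (hsupp h), integral_indicator hs]

variable {Ω : Type*} [MeasurableSpace Ω] {P : Measure Ω} {Z : Ω → E} {n : ℕ} {C m : ℝ}

theorem hasDensity_mul_sqrt_div_norm (hZ : HasLaw Z (stdGaussian E) P)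
    (hdim : Module.finrank ℝ E + 1 = n) (hC : 0 < C) (hm : 0 < m) :
    HasDensity P (fun ω => C * √m / ‖Z ω‖) (indexDensity n m C) := by
  have h := (hasLaw_div_norm_stdGaussian (E := E) (a := C * √m) (by positivity)).fun_comp hZ
  unfold HasDensity
  convert h using 5 with x
  unfold indexDensity
  have hd : 1 ≤ Module.finrank ℝ E := Module.finrank_pos
  set d := Module.finrank ℝ E
  split_ifs with hx
  · subst hdim
    have h1 : m ^ ((((d + 1 : ℕ) : ℝ) - 1) / 2) = √m ^ d := by
      rw [Real.rpow_div_two_eq_sqrt _ hm.le]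
      push_cast
      rw [add_sub_cancel_right, Real.rpow_natCast]
    have h2 : -(m / 2 * (C / x) ^ 2) = -(1 / 2) * (C * √m / x) ^ 2 := by
      rw [div_pow, div_pow, mul_pow, Real.sq_sqrt hm.le]
      ring
    have hG : Real.Gamma ((d : ℝ) / 2) ≠ 0 := (Real.Gamma_pos_of_pos (by positivity)).ne'
    rw [h1, h2]
    push_cast
    rw [show ((d : ℝ) + 1 - 3) / 2 = d / 2 - 1 by ring, add_sub_cancel_right]
    -- Writing `d = e + 1` removes the truncated subtraction in the exponent `d - 1`.
    obtain ⟨e, he⟩ := Nat.exists_eq_add_of_le' hd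
    rw [he] at hG ⊢
    simp only [Nat.add_sub_cancel]
    field_simp
    rw [div_pow, div_pow, mul_pow]
    field_simp
    ring
  · rfl

theorem integrable_and_integral_mul_sqrt_div_norm_pow (hZ : HasLaw Z (stdGaussian E) P)
    (hdim : Module.finrank ℝ E + 1 = n) (hm : 0 < m) {r : ℕ} (hr : r + 1 < n) :
    Integrable (fun ω => (C * √m / ‖Z ω‖) ^ r) P ∧
      ∫ ω, (C * √m / ‖Z ω‖) ^ r ∂P = (m / 2) ^ ((r : ℝ) / 2) *
        (Real.Gamma (((n : ℝ) - 1 - r) / 2) / Real.Gamma (((n : ℝ) - 1) / 2)) * C ^ r := by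
  obtain ⟨h1, h2⟩ := integrable_and_integral_div_norm_pow_stdGaussian (E := E) (C * √m) (r := r)
    (by omega)
  have hmeas : AEStronglyMeasurable (fun x : E => (C * √m / ‖x‖) ^ r) (stdGaussian E) :=
    (by fun_prop : Measurable fun x : E => (C * √m / ‖x‖) ^ r).aestronglyMeasurable
  refine ⟨?_, ?_⟩
  · rw [← hZ.map_eq] at h1
    exact h1.comp_aemeasurable hZ.aemeasurable
  · refine (hZ.integral_comp hmeas).trans (h2.trans ?_)
    have hn : (n : ℝ) - 1 = Module.finrank ℝ E := by rw [← hdim]; push_cast; ring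
    rw [hn, Real.div_rpow hm.le two_pos.le, Real.rpow_div_two_eq_sqrt _ hm.le, Real.rpow_natCast,
      neg_div, Real.rpow_neg two_pos.le, mul_pow]
    ring

theorem integrable_and_integral_mul_sqrt_div_norm (hZ : HasLaw Z (stdGaussian E) P)
    (hdim : Module.finrank ℝ E + 1 = n) (hm : 0 < m) (hn : 3 ≤ n) :
    Integrable (fun ω => C * √m / ‖Z ω‖) P ∧ ∫ ω, C * √m / ‖Z ω‖ ∂P =
      (√(2 / m) * Real.Gamma (((n : ℝ) - 1) / 2) / Real.Gamma (((n : ℝ) - 2) / 2))⁻¹ * C := by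
  have h := integrable_and_integral_mul_sqrt_div_norm_pow (C := C) hZ hdim hm (r := 1) (by omega)
  simp only [pow_one, Nat.cast_one] at h
  refine ⟨h.1, h.2.trans ?_⟩
  rw [show (n : ℝ) - 1 - 1 = n - 2 by ring, ← Real.sqrt_eq_rpow, inv_div, mul_comm (√(2 / m)),
    ← div_div, div_eq_mul_inv _ (√(2 / m)), ← Real.sqrt_inv, inv_div]
  ring

theorem memLp_and_variance_mul_sqrt_div_norm [IsProbabilityMeasure P]
    (hZ : HasLaw Z (stdGaussian E) P)
    (hdim : Module.finrank ℝ E + 1 = n) (hm : 0 < m) (hn : 4 ≤ n) :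
    MemLp (fun ω => C * √m / ‖Z ω‖) 2 P ∧ variance (fun ω => C * √m / ‖Z ω‖) P =
      (m / ((n : ℝ) - 3) - ((√(2 / m) * Real.Gamma (((n : ℝ) - 1) / 2) /
        Real.Gamma (((n : ℝ) - 2) / 2))⁻¹) ^ 2) * C ^ 2 := by
  obtain ⟨h1, h1'⟩ := integrable_and_integral_mul_sqrt_div_norm (C := C) hZ hdim hm (by omega)
  obtain ⟨h2, h2'⟩ := integrable_and_integral_mul_sqrt_div_norm_pow (C := C) hZ hdim hm (r := 2)
    (by omega)
  have hL := (memLp_two_iff_integrable_sq h1.aestronglyMeasurable).2 h2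
  refine ⟨hL, ?_⟩
  have hn' : (0 : ℝ) < (n : ℝ) - 3 := by
    have : (4 : ℝ) ≤ n := by exact_mod_cast hn
    linarith
  -- The Gamma recurrence collapses the ratio in the second moment to a rational function.
  have hG : Real.Gamma (((n : ℝ) - 1) / 2) =
      ((n : ℝ) - 3) / 2 * Real.Gamma (((n : ℝ) - 3) / 2) := by
    rw [← Real.Gamma_add_one (by positivity)]
    ring_nf
  have hG0 : Real.Gamma (((n : ℝ) - 3) / 2) ≠ 0 := (Real.Gamma_pos_of_pos (by positivity)).ne'
  have h3 : (m / 2) ^ (((2 : ℕ) : ℝ) / 2) *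
      (Real.Gamma (((n : ℝ) - 1 - (2 : ℕ)) / 2) / Real.Gamma (((n : ℝ) - 1) / 2)) =
      m / ((n : ℝ) - 3) := by
    push_cast
    rw [hG, show (n : ℝ) - 1 - 2 = n - 3 by ring, div_self two_ne_zero, Real.rpow_one]
    field_simp
  rw [variance_eq_sub hL, h1']
  simp only [Pi.pow_apply]
  rw [h2', h3]
  ring

end InverseNorm

/-! ### Application to the estimators -/

/-- Keeping the tolerance width `D` and the divisor `m` free covers upper and lower limits and both
variances at once. -/
theorem div_three_mul_sqrt_sample_spec {Ω : Type*} [MeasurableSpace Ω] (P : Measure Ω)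
    [IsProbabilityMeasure P] {n : ℕ} (hn : 2 ≤ n) {μ σ : ℝ} (hσ : 0 < σ) {X : Fin n → Ω → ℝ}
    (hindep : iIndepFun X P)
    (hlaw : ∀ i, HasLaw (X i) (gaussianReal μ ⟨σ ^ 2, sq_nonneg σ⟩) P)
    {D m : ℝ} (hD : 0 < D) (hm : 0 < m) {Y : Ω → ℝ}
    (hY : ∀ ω, Y ω = D / (3 * √((∑ i, (X i ω - sampleMean fun j => X j ω) ^ 2) / m))) :
    HasDensity P Y (indexDensity n m (D / (3 * σ))) ∧
      (∀ r : ℕ, r + 1 < n → Integrable (fun ω => Y ω ^ r) P ∧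
        ∫ ω, Y ω ^ r ∂P = (m / 2) ^ ((r : ℝ) / 2) *
          (Real.Gamma (((n : ℝ) - 1 - r) / 2) / Real.Gamma (((n : ℝ) - 1) / 2)) *
          (D / (3 * σ)) ^ r) ∧
      (3 ≤ n → Integrable Y P ∧ ∫ ω, Y ω ∂P =
        (√(2 / m) * Real.Gamma (((n : ℝ) - 1) / 2) / Real.Gamma (((n : ℝ) - 2) / 2))⁻¹ *
          (D / (3 * σ))) ∧
      (4 ≤ n → MemLp Y 2 P ∧ variance Y P =
        (m / ((n : ℝ) - 3) - ((√(2 / m) * Real.Gamma (((n : ℝ) - 1) / 2) /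
          Real.Gamma (((n : ℝ) - 2) / 2))⁻¹) ^ 2) * (D / (3 * σ)) ^ 2) := by
  obtain ⟨Z, hZ, hQ⟩ := exists_hasLaw_stdGaussian_sum_sq_sub_sampleMean (by omega) hσ hindep hlaw
  have hfin := finrank_centeredSubspace (n := n) (by omega)
  have hdim : Module.finrank ℝ (centeredSubspace n) + 1 = n := by omega
  have : Nontrivial (centeredSubspace n) := Module.nontrivial_of_finrank_pos (R := ℝ) (by omega)
  -- Equality holds at every `ω`: where `Z ω = 0`, both sides are `0` by the convention for
  -- division.
  obtain rfl : Y = fun ω => D / (3 * σ) * √m / ‖Z ω‖ := by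
    funext ω
    rw [hY, hQ, Real.sqrt_div' _ hm.le, ← mul_pow, Real.sqrt_sq (by positivity)]
    simp only [div_eq_mul_inv, mul_inv, inv_inv]
    ring
  exact ⟨hasDensity_mul_sqrt_div_norm hZ hdim (by positivity) hm,
    fun r hr => integrable_and_integral_mul_sqrt_div_norm_pow hZ hdim hm hr,
    fun h3 => integrable_and_integral_mul_sqrt_div_norm hZ hdim hm h3,
    fun h4 => memLp_and_variance_mul_sqrt_div_norm hZ hdim hm h4⟩

theorem div_three_mul_sqrt_div_eq {n : ℕ} (hn : 2 ≤ n) (D Q : ℝ) :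
    D / (3 * √(Q / n)) = √((n : ℝ) / ((n : ℝ) - 1)) * (D / (3 * √(Q / ((n : ℝ) - 1)))) := by
  have hn' : (2 : ℝ) ≤ n := by exact_mod_cast hn
  have h1 : (0 : ℝ) ≤ (n : ℝ) - 1 := by linarith
  have h2 : √((n : ℝ) - 1) ≠ 0 := (Real.sqrt_pos.2 (by linarith)).ne'
  rw [Real.sqrt_div' _ h1, Real.sqrt_div' _ (Nat.cast_nonneg n), Real.sqrt_div' _ h1]
  simp only [div_eq_mul_inv, mul_inv, inv_inv]
  field_simp

theorem mainTheorem5 {Ω : Type*} [MeasurableSpace Ω] (P : Measure Ω) [IsProbabilityMeasure P]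
    (n : ℕ) (hn : 2 ≤ n) (μ σ : ℝ) (hσ : 0 < σ) (T k : ℝ) (hk : 1 < k)
    (X : Fin n → Ω → ℝ) (hindep : iIndepFun X P)
    (hlaw : ∀ i, HasLaw (X i) (gaussianReal μ ⟨σ ^ 2, sq_nonneg σ⟩) P) :
    (∀ U : ℝ, T < U →
      (∀ L : ℝ, T - L = k * (U - T) → Cpu U T σ = 2 / (1 + k) * Cp L U σ) ∧
      (HasDensity P (fun ω => estCpuNm1 U T k fun i => X i ω) (densityNm1 n (Cpu U T σ)) ∧
        (∀ r : ℕ, r + 1 < n →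
          Integrable (fun ω => (estCpuNm1 U T k fun i => X i ω) ^ r) P ∧
          ∫ ω, (estCpuNm1 U T k fun i => X i ω) ^ r ∂P =
            (((n : ℝ) - 1) / 2) ^ ((r : ℝ) / 2) *
              (Real.Gamma (((n : ℝ) - 1 - r) / 2) / Real.Gamma (((n : ℝ) - 1) / 2)) *
              (Cpu U T σ) ^ r) ∧
        (3 ≤ n →
          Integrable (fun ω => estCpuNm1 U T k fun i => X i ω) P ∧
          ∫ ω, estCpuNm1 U T k (fun i => X i ω) ∂P = (bf n)⁻¹ * Cpu U T σ) ∧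
        (4 ≤ n →
          MemLp (fun ω => estCpuNm1 U T k fun i => X i ω) 2 P ∧
          variance (fun ω => estCpuNm1 U T k fun i => X i ω) P =
            (((n : ℝ) - 1) / ((n : ℝ) - 3) - ((bf n)⁻¹) ^ 2) * (Cpu U T σ) ^ 2)) ∧
      (∀ x : Fin n → ℝ, estCpuN U T k x =
          Real.sqrt ((n : ℝ) / ((n : ℝ) - 1)) * estCpuNm1 U T k x) ∧
      (HasDensity P (fun ω => estCpuN U T k fun i => X i ω) (densityN n (Cpu U T σ)) ∧
        (∀ r : ℕ, r + 1 < n →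
          Integrable (fun ω => (estCpuN U T k fun i => X i ω) ^ r) P ∧
          ∫ ω, (estCpuN U T k fun i => X i ω) ^ r ∂P =
            ((n : ℝ) / 2) ^ ((r : ℝ) / 2) *
              (Real.Gamma (((n : ℝ) - 1 - r) / 2) / Real.Gamma (((n : ℝ) - 1) / 2)) *
              (Cpu U T σ) ^ r) ∧
        (3 ≤ n →
          Integrable (fun ω => estCpuN U T k fun i => X i ω) P ∧
          ∫ ω, estCpuN U T k (fun i => X i ω) ∂P = (cf n)⁻¹ * Cpu U T σ) ∧
        (4 ≤ n →
          MemLp (fun ω => estCpuN U T k fun i => X i ω) 2 P ∧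
          variance (fun ω => estCpuN U T k fun i => X i ω) P =
            ((n : ℝ) / ((n : ℝ) - 3) - ((cf n)⁻¹) ^ 2) * (Cpu U T σ) ^ 2))) ∧
    (∀ L : ℝ, L < T →
      (∀ U : ℝ, U - T = k * (T - L) → Cpl L T σ = 2 / (1 + k) * Cp L U σ) ∧
      (HasDensity P (fun ω => estCplNm1 L T k fun i => X i ω) (densityNm1 n (Cpl L T σ)) ∧
        (∀ r : ℕ, r + 1 < n →
          Integrable (fun ω => (estCplNm1 L T k fun i => X i ω) ^ r) P ∧
          ∫ ω, (estCplNm1 L T k fun i => X i ω) ^ r ∂P =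
            (((n : ℝ) - 1) / 2) ^ ((r : ℝ) / 2) *
              (Real.Gamma (((n : ℝ) - 1 - r) / 2) / Real.Gamma (((n : ℝ) - 1) / 2)) *
              (Cpl L T σ) ^ r) ∧
        (3 ≤ n →
          Integrable (fun ω => estCplNm1 L T k fun i => X i ω) P ∧
          ∫ ω, estCplNm1 L T k (fun i => X i ω) ∂P = (bf n)⁻¹ * Cpl L T σ) ∧
        (4 ≤ n →
          MemLp (fun ω => estCplNm1 L T k fun i => X i ω) 2 P ∧
          variance (fun ω => estCplNm1 L T k fun i => X i ω) P =
            (((n : ℝ) - 1) / ((n : ℝ) - 3) - ((bf n)⁻¹) ^ 2) * (Cpl L T σ) ^ 2)) ∧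
      (∀ x : Fin n → ℝ, estCplN L T k x =
          Real.sqrt ((n : ℝ) / ((n : ℝ) - 1)) * estCplNm1 L T k x) ∧
      (HasDensity P (fun ω => estCplN L T k fun i => X i ω) (densityN n (Cpl L T σ)) ∧
        (∀ r : ℕ, r + 1 < n →
          Integrable (fun ω => (estCplN L T k fun i => X i ω) ^ r) P ∧
          ∫ ω, (estCplN L T k fun i => X i ω) ^ r ∂P =
            ((n : ℝ) / 2) ^ ((r : ℝ) / 2) *
              (Real.Gamma (((n : ℝ) - 1 - r) / 2) / Real.Gamma (((n : ℝ) - 1) / 2)) *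
              (Cpl L T σ) ^ r) ∧
        (3 ≤ n →
          Integrable (fun ω => estCplN L T k fun i => X i ω) P ∧
          ∫ ω, estCplN L T k (fun i => X i ω) ∂P = (cf n)⁻¹ * Cpl L T σ) ∧
        (4 ≤ n →
          MemLp (fun ω => estCplN L T k fun i => X i ω) 2 P ∧
          variance (fun ω => estCplN L T k fun i => X i ω) P =
            ((n : ℝ) / ((n : ℝ) - 3) - ((cf n)⁻¹) ^ 2) * (Cpl L T σ) ^ 2))) := by
  have hn' : (2 : ℝ) ≤ n := by exact_mod_cast hn
  have hk' : 1 + k ≠ 0 := by linarith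
  refine ⟨fun U hU => ⟨fun L hL => ?_, ?_, fun x => ?_, ?_⟩,
    fun L hL => ⟨fun U hU => ?_, ?_, fun x => ?_, ?_⟩⟩
  · rw [Cpu, Cp, show U - L = (1 + k) * (U - T) by linarith]
    field_simp
    ring
  -- `densityNm1`, `bf` and `Cpu` unfold to the general expressions at `m = n - 1`; with `u = v = 0`
  -- the deviation term, and with it `k`, disappears.
  · exact div_three_mul_sqrt_sample_spec P hn hσ hindep hlaw (sub_pos.2 hU) (by linarith)
      fun ω => by simp [estCpuNm1, estUFamilyNm1, sampleVarNm1]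
  · simpa [estCpuN, estUFamilyN, sampleVarN, estCpuNm1, estUFamilyNm1, sampleVarNm1] using
      div_three_mul_sqrt_div_eq hn _ _
  · exact div_three_mul_sqrt_sample_spec P hn hσ hindep hlaw (sub_pos.2 hU) (by linarith)
      fun ω => by simp [estCpuN, estUFamilyN, sampleVarN]
  · rw [Cpl, Cp, show U - L = (1 + k) * (T - L) by linarith]
    field_simp
    ring
  · exact div_three_mul_sqrt_sample_spec P hn hσ hindep hlaw (sub_pos.2 hL) (by linarith)
      fun ω => by simp [estCplNm1, estLFamilyNm1, sampleVarNm1]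
  · simpa [estCplN, estLFamilyN, sampleVarN, estCplNm1, estLFamilyNm1, sampleVarNm1] using
      div_three_mul_sqrt_div_eq hn _ _
  · exact div_three_mul_sqrt_sample_spec P hn hσ hindep hlaw (sub_pos.2 hL) (by linarith)
      fun ω => by simp [estCplN, estLFamilyN, sampleVarN]
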